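/- \textbf{Definitions.} Let $\{B_n\}_n$ be a sequence of complex matrices, $B_n$ of size $d_n\to\infty$, and let $f:D\to\mathbb C$ be measurable on a measurable set $D\subset\mathbb R^t$ with $0<\mu_t(D)<\infty$ ($\mu_t$ is Lebesgue measure). Write $\{B_n\}_n\sim_\lambda f$ if, for every continuous compactly supported $F:\mathbb C\to\mathbb C$, $$\lim_{n\to\infty}\frac1{d_n}\sum_{i=1}^{d_n}F(\lambda_i(B_n))=\frac1{\mu_t(D)}\int_D F(f(\mathbf x))\,d\mathbf x ,$$ where $\lambda_1(B_n),\dots,\lambda_{d_n}(B_n)$ are the eigenvalues of $B_n$ counted with algebraic multiplicity. \textbf{The Coco--Russo matrix in $1\mathbb D$.} Let $b\in\mathbb R$. For each $n\ge1$ let $x_0=x_0^{(n)}$ and $a=a^{(n)}$ be real numbers with $x_0<a<x_1:=x_0+h$, where $h=(b-x_0)/(n+1)$, and put $\vartheta=(x_1-a)/h$ (so $x_0$ is the ghost point of the uniform grid $x_i=x_0+ih$, $x_{n+1}=b$, for the problem on $(a,b)$; $a$ may in particular be independent of $n$). Let $$A_h=\begin{bmatrix}\vartheta&1-\vartheta&0&\cdots&0\\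 -\frac1{h^2}&\frac2{h^2}&-\frac1{h^2}&&\vdots\\ 0&\ddots&\ddots&\ddots&0\\ \vdots&&-\frac1{h^2}&\frac2{h^2}&-\frac1{h^2}\\ 0&\cdots&0&-\frac1{h^2}&\frac2{h^2}\end{bmatrix}\in\mathbb R^{(n+1)\times(n+1)} .$$ \textbf{The Coco--Russo matrix in $2\mathbb D$} (for the domain $[0,1]\times[a,1]$, with ghost points on the side $y=0$). For each $n\ge1$ let $h=1/(n+1)$, let $a=a^{(n)}$ satisfy $0<a<h$, and put $\vartheta_S=(h-a)/h$. Let $A_h\in\mathbb R^{n(n+1)\times n(n+1)}$ be the block matrix with $(n+1)\times(n+1)$ blocks of size $n\times n$ $$A_h=\begin{bmatrix}\vartheta_S I_n&(1-\vartheta_S)I_n&&&\\ B&G&B&&\\ &\ddots&\ddots&\ddots&\\ &&B&G&B\\ &&&B&G\end{bmatrix},\qquad B=-\frac1{h^2}I_n,\qquad G=\frac1{h^2}\,\mathrm{tridiag}(-1,4,-1)\in\mathbb R^{n\times n}.$$ \textbf{Theorem.} For every choice of these data, as $n\to\infty$, $$\{h^2A_h\}\sim_\lambda 2-2\cos\theta\quad(\theta\in[-\pi,\pi])\quad\text{in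 }1\mathbb D,$$ $$\{h^2A_h\}\sim_\lambda 4-2\cos\theta_1-2\cos\theta_2\quad((\theta_1,\theta_2)\in[-\pi,\pi]^2)\quad\text{in }2\mathbb D.$$ -/

import Mathlib

open Filter Topology MeasureTheory

noncomputable section

namespace CocoRusso

/-- The average `(1 / d) * ∑ i, F (λ i)` over the `d` complex eigenvalues of a `d × d` matrix,
counted with algebraic multiplicity (they are the roots of the characteristic polynomial). -/
def eigenvalueMean {ι : Type} [Fintype ι] [DecidableEq ι] (A : Matrix ι ι ℂ) (F : ℂ → ℂ) : ℂ :=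
  (Fintype.card ι : ℂ)⁻¹ * (A.charpoly.roots.map F).sum

/-- `{A n}` has the (asymptotic) spectral distribution described by the measurable function
`f : D → ℂ`, where `D ⊆ ℝ ^ t` is measurable with `0 < μ(D) < ∞`. -/
structure HasSpectralDistribution {ι : ℕ → Type} [∀ n, Fintype (ι n)] [∀ n, DecidableEq (ι n)]
    (A : (n : ℕ) → Matrix (ι n) (ι n) ℂ) {t : ℕ} (D : Set (Fin t → ℝ))
    (f : (Fin t → ℝ) → ℂ) : Prop where
  measurableSet_domain : MeasurableSet D
  volume_domain_pos : 0 < volume D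
  volume_domain_lt_top : volume D < ⊤
  measurable_symbol : Measurable (D.domRestrict f)
  tendsto_eigenvalueMean : ∀ F : ℂ → ℂ, Continuous F → HasCompactSupport F →
    Tendsto (fun n => eigenvalueMean (A n) F) atTop
      (𝓝 (((volume D).toReal : ℂ)⁻¹ * ∫ x in D, F (f x)))

/-- The cube `[-π, π] ^ t`. -/
def angleCube (t : ℕ) : Set (Fin t → ℝ) :=
  Set.Icc (fun _ => -Real.pi) (fun _ => Real.pi)

/-! ### One dimension -/

/-- Step of the uniform grid `x₀, x₁, …, x_{n+1} = b`. -/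
def step1D (b x₀ : ℝ) (n : ℕ) : ℝ := (b - x₀) / ((n : ℝ) + 1)

/-- `ϑ = (x₁ - a) / h`, where `x₁ = x₀ + h` is the first grid point to the right of the
boundary point `a`, and `x₀` is the ghost point. -/
def theta (x₀ h a : ℝ) : ℝ := (x₀ + h - a) / h

/-- The `(n + 1) × (n + 1)` matrix of the Coco--Russo method for `-u'' = f`, `u(a) = g_a`,
`u(b) = g_b`, acting on `(u₀, …, u_n)`. Row `0` is the linear interpolation
`ϑ u₀ + (1 - ϑ) u₁` of the boundary value at `a`; row `i ≥ 1` is the central difference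
`(-u_{i-1} + 2 u_i - u_{i+1}) / h²`, with `u_{n+1}` eliminated in row `n`. -/
def matrix1D (n : ℕ) (h ϑ : ℝ) : Matrix (Fin (n + 1)) (Fin (n + 1)) ℝ :=
  Matrix.of fun i j =>
    if i.val = 0 then
      if j.val = 0 then ϑ else if j.val = 1 then 1 - ϑ else 0
    else if i.val = j.val then 2 / h ^ 2
    else if i.val = j.val + 1 ∨ j.val = i.val + 1 then -(1 / h ^ 2)
    else 0

/-! ### Two dimensions -/

/-- The step `h = 1 / (n + 1)` of the uniform grid `(x_i, y_j) = (i h, j h)`,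
`i, j = 0, …, n + 1`, of the unit square. -/
def step2D (n : ℕ) : ℝ := 1 / ((n : ℝ) + 1)

/-- The `n × n` block `G = h⁻² tridiag(-1, 4, -1)`. -/
def blockG (n : ℕ) (h : ℝ) : Matrix (Fin n) (Fin n) ℝ :=
  Matrix.of fun i j =>
    if i.val = j.val then 4 / h ^ 2
    else if i.val = j.val + 1 ∨ j.val = i.val + 1 then -(1 / h ^ 2)
    else 0

/-- The `n × n` block `B = -h⁻² I`. -/
def blockB (n : ℕ) (h : ℝ) : Matrix (Fin n) (Fin n) ℝ :=
  (-(1 / h ^ 2)) • (1 : Matrix (Fin n) (Fin n) ℝ)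

/-- The block in block row `r` and block column `s`. Block row `r` collects the equations
on the grid line `y = r h`, block row `0` being the one of the ghost points. -/
def block2D (n : ℕ) (h ϑ : ℝ) (r s : Fin (n + 1)) : Matrix (Fin n) (Fin n) ℝ :=
  if r.val = 0 then
    if s.val = 0 then ϑ • (1 : Matrix (Fin n) (Fin n) ℝ)
    else if s.val = 1 then (1 - ϑ) • (1 : Matrix (Fin n) (Fin n) ℝ)
    else 0
  else if r.val = s.val then blockG n h
  else if r.val = s.val + 1 ∨ s.val = r.val + 1 then blockB n h
  else 0

/-- The `(n + 1) n × (n + 1) n` matrix of the Coco--Russo method for `-Δu = f` on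
`[0, 1] × [a, 1]` with Dirichlet data. The index `(r, i)` stands for the unknown at the grid
point `((i + 1) h, r h)`; the first component is the block index. -/
def matrix2D (n : ℕ) (h ϑ : ℝ) : Matrix (Fin (n + 1) × Fin n) (Fin (n + 1) × Fin n) ℝ :=
  Matrix.of fun p q => block2D n h ϑ p.1 q.1 p.2 q.2

/-! ### The scaled matrices `h² A_h`, as complex matrices -/

/-- `h² A_h` in one dimension. -/
def scaledMatrix1D (b x₀ a : ℝ) (n : ℕ) : Matrix (Fin (n + 1)) (Fin (n + 1)) ℂ :=
  ((step1D b x₀ n) ^ 2 • matrix1D n (step1D b x₀ n) (theta x₀ (step1D b x₀ n) a)).map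
    Complex.ofReal

/-- `h² A_h` in two dimensions; the ghost points lie on `y = 0`. -/
def scaledMatrix2D (a : ℝ) (n : ℕ) : Matrix (Fin (n + 1) × Fin n) (Fin (n + 1) × Fin n) ℂ :=
  ((step2D n) ^ 2 • matrix2D n (step2D n) (theta 0 (step2D n) a)).map Complex.ofReal

end CocoRusso

end

namespace CocoRusso

/-! ### Eigenvalues from independent eigenvectors -/

/-! All but a vanishing fraction of the eigenvalues can be located explicitly, so no perturbation
argument for non-normal matrices is needed.

In 1D the scaled matrix is `tridiag(-1, 2, -1)` except for its first row `(α, β)`, where `β = h²(1 -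
ϑ) > 0`. The vector `sin((n + 1 - i)φ)` satisfies every row but the first with eigenvalue `2 - 2 cos
φ`; the first row becomes a scalar secular equation in `φ`. At the nodes `mπ/(n + 1)` the `α`-term
vanishes, and the remaining `β`-term alternates in sign, so each of the `n - 1` inner cells between
consecutive nodes contains a root (`exists_angle`). This gives `n - 1` distinct eigenvalues out of
`n + 1`, one per cell, whatever the sizes of `h` and `ϑ`. The eigenvalue sum of a bounded `F` thus
differs by a bounded amount from a Riemann sum over `[0, π]`, and the evenness of the symbol turns
the limit into the mean over `[-π, π]`.

In 2D the variables separate (`scaledMatrix2D_mulVec`): each sine eigenvector of `tridiag(-1, 4,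
-1)`, with eigenvalue `γ = 4 - 2 cos θ_k`, reduces the problem to the 1D one with `γ` on the
diagonal. This yields `n(n - 1)` of the `n(n + 1)` eigenvalues; the error is `O(n)` against `n²`. -/

/-- The eigenvalues of linearly independent eigenvectors are, with multiplicity, among the roots
of the characteristic polynomial. -/
theorem map_le_roots_charpoly {ι κ : Type*} [Fintype ι] [DecidableEq ι] [Fintype κ]
    (A : Matrix ι ι ℂ) (w : κ → ι → ℂ) (μ : κ → ℂ) (hw : LinearIndependent ℂ w)
    (h : ∀ k, A.mulVec (w k) = μ k • w k) :
    (Finset.univ : Finset κ).val.map μ ≤ A.charpoly.roots := by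
  classical
  rw [Multiset.le_iff_count]
  intro x
  rw [Polynomial.count_roots, Multiset.count_map]
  -- Geometric multiplicity is at most algebraic multiplicity; the `w k` with `μ k = x` bound the
  -- former from below.
  have hle := LinearMap.finrank_eigenspace_le (Matrix.toLin' A) x
  rw [Matrix.charpoly_toLin'] at hle
  refine le_trans ?_ hle
  have hmem : ∀ k : {k // x = μ k}, w k ∈ Module.End.eigenspace (Matrix.toLin' A) x := fun k => by
    rw [Module.End.mem_eigenspace_iff, Matrix.toLin'_apply, h]
    exact congrArg (· • w k) k.2.symm
  have hli : LinearIndependent ℂ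
      (fun k : {k // x = μ k} => (⟨w k, hmem k⟩ : Module.End.eigenspace (Matrix.toLin' A) x)) :=
    LinearIndependent.of_comp (Submodule.subtype _)
      (hw.comp (fun k : {k // x = μ k} => (k : κ)) Subtype.val_injective)
  have hcard := hli.fintype_card_le_finrank
  rw [Fintype.card_subtype] at hcard
  exact hcard

theorem linearIndependent_of_eigenvectors {ι κ : Type*} [Fintype ι] [DecidableEq ι]
    (A : Matrix ι ι ℂ) (w : κ → ι → ℂ) (μ : κ → ℂ) (hμ : Function.Injective μ)
    (h0 : ∀ k, w k ≠ 0) (h : ∀ k, A.mulVec (w k) = μ k • w k) : LinearIndependent ℂ w :=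
  Module.End.eigenvectors_linearIndependent' (Matrix.toLin' A) μ hμ w fun k =>
    Module.End.hasEigenvector_iff.2
      ⟨by rw [Module.End.mem_eigenspace_iff, Matrix.toLin'_apply, h], h0 k⟩

/-- Products of independent families are independent, even if the second factor depends on
the first. -/
theorem linearIndependent_mul {ι ι' κ κ' : Type*} [Fintype κ] [Fintype κ']
    (v : κ → ι → ℂ) (u : κ → κ' → ι' → ℂ) (hv : LinearIndependent ℂ v)
    (hu : ∀ k, LinearIndependent ℂ (u k)) :
    LinearIndependent ℂ (fun (p : κ × κ') (q : ι' × ι) => u p.1 p.2 q.1 * v p.1 q.2) := by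
  rw [Fintype.linearIndependent_iff]
  intro c hc
  have hsum : ∀ k, ∑ j, c (k, j) • u k j = 0 := by
    intro k
    funext r
    -- With the `ι'`-coordinate fixed at `r`, the relation becomes one among the `v k` alone, whose
    -- coefficients are the values at `r` of the sums to be killed.
    refine Fintype.linearIndependent_iff.1 hv (fun k => (∑ j, c (k, j) • u k j) r) ?_ k
    funext i
    have := congrFun hc (r, i)
    simp only [Finset.sum_apply, Pi.smul_apply, smul_eq_mul, Fintype.sum_prod_type,
      Pi.zero_apply] at this ⊢
    rw [← this]
    refine Finset.sum_congr rfl fun k _ => ?_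
    rw [Finset.sum_mul]
    exact Finset.sum_congr rfl fun j _ => by ring
  rintro ⟨k, j⟩
  exact Fintype.linearIndependent_iff.1 (hu k) (fun j => c (k, j)) (hsum k) j

theorem norm_sum_map_le (F : ℂ → ℂ) (M : ℝ) (hM : ∀ z, ‖F z‖ ≤ M) (s : Multiset ℂ) :
    ‖(s.map F).sum‖ ≤ s.card * M := by
  induction s using Multiset.induction with
  | empty => simp
  | cons a s ih =>
    simp only [Multiset.map_cons, Multiset.sum_cons, Multiset.card_cons, Nat.cast_add,
      Nat.cast_one, add_mul, one_mul]
    linarith [norm_add_le (F a) (s.map F).sum, hM a]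

/-- The common part `s` cancels; each of the remaining elements of `r` and `t` costs at most `M`. It
is applied with `r` the spectrum, `t` the full sampling grid and `s` the eigenvalues found
explicitly. -/
theorem norm_sum_map_sub_le (F : ℂ → ℂ) (M : ℝ) (hM : ∀ z, ‖F z‖ ≤ M) {s r t : Multiset ℂ}
    (hr : s ≤ r) (ht : s ≤ t) :
    ‖(r.map F).sum - (t.map F).sum‖ ≤ ((r.card : ℝ) + t.card - 2 * s.card) * M := by
  obtain ⟨u, rfl⟩ := Multiset.le_iff_exists_add.1 hr
  obtain ⟨v, rfl⟩ := Multiset.le_iff_exists_add.1 ht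
  have hu := norm_sum_map_le F M hM u
  have hv := norm_sum_map_le F M hM v
  simp only [Multiset.map_add, Multiset.sum_add, Multiset.card_add, Nat.cast_add,
    add_sub_add_left_eq_sub]
  linarith [norm_sub_le (u.map F).sum (v.map F).sum]

/-! ### Tridiagonal matrices -/

/-- The vector is extended by phantom values `w 0` and `w (N + 1)`, so that boundary rows look like
interior ones. The condition on `w 0` is asked only in row `0`, because the ghost matrices use this
sum in their other rows with a `w 0` that need not vanish. -/
theorem sum_tridiagonal (N : ℕ) (a b : ℂ) (w : ℕ → ℂ) (i : Fin N)
    (h0 : i.val = 0 → w 0 = 0) (hN : w (N + 1) = 0) :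
    ∑ j : Fin N, (if i.val = j.val then a
      else if i.val = j.val + 1 ∨ j.val = i.val + 1 then b else 0) * w (j.val + 1) =
      b * w i.val + a * w (i.val + 1) + b * w (i.val + 2) := by
  obtain ⟨i, hi⟩ := i
  simp only at h0 ⊢
  have hsplit : ∀ j : ℕ, (if i = j then a
      else if i = j + 1 ∨ j = i + 1 then b else 0) * w (j + 1) =
      (if j + 1 = i then b * w i else 0) + (if i = j then a * w (i + 1) else 0)
        + (if i + 1 = j then b * w (i + 2) else 0) := by
    intro j
    by_cases h1 : i = j
    · subst h1; simp
    · by_cases h2 : i = j + 1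
      · subst h2; simp; omega
      · by_cases h3 : j = i + 1
        · subst h3; simp; omega
        · have h2' : ¬ j + 1 = i := fun h => h2 h.symm
          have h3' : ¬ i + 1 = j := fun h => h3 h.symm
          simp [h1, h2, h3, h2', h3']
  rw [Fin.sum_univ_eq_sum_range (fun j => (if i = j then a
      else if i = j + 1 ∨ j = i + 1 then b else 0) * w (j + 1)) N]
  simp only [hsplit, Finset.sum_add_distrib]
  congr 1
  · congr 1
    · rcases i with _ | i
      · simp [h0]
      · simp only [Nat.add_right_cancel_iff, Finset.sum_ite_eq', Finset.mem_range]
        rw [if_pos (by omega)]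
    · simp [hi]
  · rw [Finset.sum_ite_eq]
    split_ifs with h
    · rfl
    · have : i + 2 = N + 1 := by simp at h; omega
      rw [this, hN, mul_zero]

/-- The tridiagonal matrix with rows `(-1, γ, -1)`, except for its first row `(α, β)`. -/
def ghostTridiagonal (n : ℕ) (α β γ : ℂ) : Matrix (Fin (n + 1)) (Fin (n + 1)) ℂ :=
  Matrix.of fun i j =>
    if i.val = 0 then
      if j.val = 0 then α else if j.val = 1 then β else 0
    else if i.val = j.val then γ
    else if i.val = j.val + 1 ∨ j.val = i.val + 1 then -1
    else 0

/-- The sine vanishes at the eliminated index `i = n + 1`, so the last row obeys the same three-term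
recurrence as the interior ones. The hypothesis `h` is exactly row `0`. -/
theorem ghostTridiagonal_mulVec {n : ℕ} (hn : 1 ≤ n) (α β γ φ : ℝ)
    (h : (α - γ + 2 * Real.cos φ) * Real.sin ((n + 1) * φ) + β * Real.sin (n * φ) = 0) :
    (ghostTridiagonal n α β γ).mulVec
        (fun i => ((Real.sin ((n + 1 - i.val) * φ) : ℝ) : ℂ)) =
      ((γ - 2 * Real.cos φ : ℝ) : ℂ) •
        (fun i : Fin (n + 1) => ((Real.sin ((n + 1 - i.val) * φ) : ℝ) : ℂ)) := by
  funext i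
  simp only [Matrix.mulVec, dotProduct, ghostTridiagonal, Matrix.of_apply, Pi.smul_apply,
    smul_eq_mul]
  by_cases hi : i.val = 0
  · obtain ⟨m, rfl⟩ : ∃ m, n = m + 1 := ⟨n - 1, by omega⟩
    simp only [hi, if_true]
    rw [Fin.sum_univ_succ, Fin.sum_univ_succ]
    simp only [Fin.val_zero, Fin.val_succ]
    simp only [if_true, CharP.cast_eq_zero, sub_zero, Nat.succ_ne_zero, if_false,
      Nat.add_eq_right, zero_mul, Finset.sum_const_zero, zero_add, add_zero, Nat.cast_one]
    push_cast at h ⊢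
    have hc := congrArg (fun x : ℝ => (x : ℂ)) h
    push_cast at hc
    rw [show ((m : ℂ) + 1 + 1 - 1) = m + 1 by ring]
    linear_combination hc
  · have hs := sum_tridiagonal (n + 1) γ (-1)
      (fun m : ℕ => ((Real.sin ((n + 2 - m) * φ) : ℝ) : ℂ)) i (fun h0 => absurd h0 hi)
      (by push_cast; ring_nf; simp)
    have hs' : ∀ j : ℕ, ((n : ℝ) + 2 - ((j + 1 : ℕ) : ℝ)) = n + 1 - j := fun j => by
      push_cast; ring
    simp only [hs'] at hs
    simp only [hi, if_false]
    rw [hs, show ((n : ℝ) + 2 - i.val) * φ = (n + 1 - i.val) * φ + φ by ring,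
      show ((n : ℝ) + 1 - ((i.val + 1 : ℕ) : ℝ)) * φ = (n + 1 - i.val) * φ - φ by
        push_cast; ring,
      Real.sin_add, Real.sin_sub]
    push_cast
    ring

/-- A solution of the secular equation of `ghostTridiagonal` in each inner cell. -/
theorem exists_angle (n : ℕ) (c : ℝ) {β : ℝ} (hβ : 0 < β) (j : ℕ) :
    ∃ φ : ℝ, j * (Real.pi / (n + 1)) ≤ φ ∧ φ ≤ (j + 1) * (Real.pi / (n + 1)) ∧
      (1 ≤ j → j < n → j * (Real.pi / (n + 1)) < φ ∧ φ < (j + 1) * (Real.pi / (n + 1)) ∧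
        (c + 2 * Real.cos φ) * Real.sin ((n + 1) * φ) + β * Real.sin (n * φ) = 0) := by
  have hn : (0 : ℝ) < n + 1 := by positivity
  have hδ : 0 < Real.pi / (n + 1) := by positivity
  -- Outside the inner cells there is no sign change to exploit; the left endpoint serves as a
  -- filler sample point.
  by_cases hj : 1 ≤ j ∧ j < n
  swap
  · exact ⟨j * (Real.pi / (n + 1)), le_rfl, by nlinarith, fun h1 h2 => absurd ⟨h1, h2⟩ hj⟩
  obtain ⟨hj1, hjn⟩ := hj
  set s : ℝ → ℝ := fun φ =>
    (c + 2 * Real.cos φ) * Real.sin ((n + 1) * φ) + β * Real.sin (n * φ) with hs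
  -- At a node `sin((n + 1)φ) = sin(mπ) = 0`, so `c` drops out and the sign is that of `(-1)^(m+1)`.
  -- The bounds `1 ≤ j < n` keep both endpoints of the cell off `0` and `π`, where the value would
  -- be zero.
  have hval : ∀ m : ℕ, s (m * (Real.pi / (n + 1))) =
      (-1) ^ m * (-(β * Real.sin (m * (Real.pi / (n + 1))))) := by
    intro m
    have h1 : ((n : ℝ) + 1) * (m * (Real.pi / (n + 1))) = m * Real.pi := by field_simp
    have h2 : (n : ℝ) * (m * (Real.pi / (n + 1))) =
        m * Real.pi - m * (Real.pi / (n + 1)) := by field_simp; ring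
    simp only [hs]
    rw [h1, h2, Real.sin_nat_mul_pi, Real.sin_nat_mul_pi_sub]
    ring
  have hpos : ∀ m : ℕ, 1 ≤ m → m ≤ n → 0 < β * Real.sin (m * (Real.pi / (n + 1))) := by
    intro m h1 h2
    have h1' : (1 : ℝ) ≤ m := by exact_mod_cast h1
    have h2' : (m : ℝ) < n + 1 := by exact_mod_cast Nat.lt_succ_of_le h2
    refine mul_pos hβ (Real.sin_pos_of_pos_of_lt_pi (by positivity) ?_)
    calc (m : ℝ) * (Real.pi / (n + 1)) < (n + 1) * (Real.pi / (n + 1)) := by gcongr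
      _ = Real.pi := by field_simp
  have hcont : Continuous s := by fun_prop
  have hlt : (j : ℝ) * (Real.pi / (n + 1)) < ((j + 1 : ℕ) : ℝ) * (Real.pi / (n + 1)) := by
    push_cast; nlinarith
  have hp := hpos j hj1 hjn.le
  have hq := hpos (j + 1) (by omega) hjn
  have hvj := hval j
  have hvj1 := hval (j + 1)
  have hroot : (0 : ℝ) ∈ s '' Set.Ioo (j * (Real.pi / (n + 1)))
      (((j + 1 : ℕ) : ℝ) * (Real.pi / (n + 1))) := by
    rcases Nat.even_or_odd j with he | ho
    · rw [he.neg_one_pow] at hvj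
      rw [he.add_one.neg_one_pow] at hvj1
      exact intermediate_value_Ioo hlt.le hcont.continuousOn ⟨by linarith, by linarith⟩
    · rw [ho.neg_one_pow] at hvj
      rw [ho.add_one.neg_one_pow] at hvj1
      exact intermediate_value_Ioo' hlt.le hcont.continuousOn ⟨by linarith, by linarith⟩
  obtain ⟨φ, ⟨h1, h2⟩, h3⟩ := hroot
  push_cast at h2
  exact ⟨φ, h1.le, h2.le, fun _ _ => ⟨h1, h2, h3⟩⟩

/-! ### Riemann sums -/

/-- The sample points are arbitrary within their cells, since the secular roots are known only up to
their cell. -/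
theorem norm_riemannSum_sub_integral_le {g : ℝ → ℂ} (hg : Continuous g) {N : ℕ} (hN : 0 < N)
    {ε : ℝ} (hε : ∀ x y, |x - y| ≤ Real.pi / N → ‖g x - g y‖ ≤ ε) (φ : ℕ → ℝ)
    (hφ : ∀ j < N, j * (Real.pi / N) ≤ φ j ∧ φ j ≤ (j + 1) * (Real.pi / N)) :
    ‖((Real.pi / N : ℝ) : ℂ) * ∑ j ∈ Finset.range N, g (φ j) - ∫ x in (0)..Real.pi, g x‖ ≤
      Real.pi * ε := by
  have hN' : (0 : ℝ) < N := by exact_mod_cast hN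
  have hδ : 0 < Real.pi / N := by positivity
  have hadj := intervalIntegral.sum_integral_adjacent_intervals (f := g) (μ := volume)
    (a := fun j : ℕ => (j : ℝ) * (Real.pi / N)) (n := N)
    (fun k _ => hg.intervalIntegrable _ _)
  have hend : (N : ℝ) * (Real.pi / N) = Real.pi := by field_simp
  simp only [Nat.cast_zero, zero_mul, hend] at hadj
  rw [← hadj, Finset.mul_sum, ← Finset.sum_sub_distrib]
  have hcell : ∀ j ∈ Finset.range N, ‖((Real.pi / N : ℝ) : ℂ) * g (φ j) -
      ∫ x in (j * (Real.pi / N))..(((j + 1 : ℕ) : ℝ) * (Real.pi / N)), g x‖ ≤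
        ε * (Real.pi / N) := by
    intro j hj
    obtain ⟨h1, h2⟩ := hφ j (Finset.mem_range.1 hj)
    have hlen : ((j + 1 : ℕ) : ℝ) * (Real.pi / N) - j * (Real.pi / N) = Real.pi / N := by
      push_cast; ring
    have hconst : ((Real.pi / N : ℝ) : ℂ) * g (φ j) =
        ∫ _ in (j * (Real.pi / N))..(((j + 1 : ℕ) : ℝ) * (Real.pi / N)), g (φ j) := by
      rw [intervalIntegral.integral_const, hlen, Complex.real_smul]
    rw [hconst, ← intervalIntegral.integral_sub (by simp) (hg.intervalIntegrable _ _)]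
    refine (intervalIntegral.norm_integral_le_of_norm_le_const (C := ε) ?_).trans ?_
    · intro x hx
      rw [Set.uIoc_of_le (by linarith)] at hx
      have := hx.2
      have := hx.1
      push_cast at *
      refine hε _ _ (abs_le.2 ⟨by linarith, by linarith⟩)
    · rw [hlen, abs_of_pos hδ]
  refine (norm_sum_le_of_le _ hcell).trans (le_of_eq ?_)
  rw [Finset.sum_const, Finset.card_range, nsmul_eq_mul]
  field_simp

theorem continuous_integral_right {g : ℝ × ℝ → ℂ} (hg : Continuous g) (a b : ℝ) :
    Continuous fun x => ∫ y in a..b, g (x, y) :=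
  intervalIntegral.continuous_parametric_intervalIntegral_of_continuous' (f := fun x y => g (x, y))
    (by simpa [Function.uncurry_def] using hg) a b

/-- The inner sample points may depend on `k`, as the secular equation does in 2D, so the grid is
not a product. The inner sums are first replaced by slice integrals, then the outer sum by an
integral; each replacement costs `π² ε`. -/
theorem norm_riemannSum_sub_integral_le₂ {g : ℝ × ℝ → ℂ} (hg : Continuous g) {N : ℕ}
    (hN : 0 < N) {ε : ℝ}
    (hε : ∀ x y x' y', |x - x'| ≤ Real.pi / N → |y - y'| ≤ Real.pi / N →
      ‖g (x, y) - g (x', y')‖ ≤ ε) (θ : ℕ → ℝ) (φ : ℕ → ℕ → ℝ)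
    (hθ : ∀ j < N, j * (Real.pi / N) ≤ θ j ∧ θ j ≤ (j + 1) * (Real.pi / N))
    (hφ : ∀ k < N, ∀ j < N, j * (Real.pi / N) ≤ φ k j ∧ φ k j ≤ (j + 1) * (Real.pi / N)) :
    ‖((Real.pi / N : ℝ) : ℂ) ^ 2 *
        ∑ k ∈ Finset.range N, ∑ j ∈ Finset.range N, g (θ k, φ k j) -
      ∫ x in (0)..Real.pi, ∫ y in (0)..Real.pi, g (x, y)‖ ≤ 2 * Real.pi ^ 2 * ε := by
  have hN' : (0 : ℝ) < N := by exact_mod_cast hN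
  have hδ : 0 < Real.pi / N := by positivity
  set G : ℝ → ℂ := fun x => ∫ y in (0)..Real.pi, g (x, y) with hG
  have hGc : Continuous G := continuous_integral_right hg _ _
  have hslice : ∀ x, Continuous fun y => g (x, y) := fun x => by fun_prop
  have hGε : ∀ x x', |x - x'| ≤ Real.pi / N → ‖G x - G x'‖ ≤ Real.pi * ε := by
    intro x x' hx
    simp only [hG]
    rw [← intervalIntegral.integral_sub ((hslice x).intervalIntegrable _ _)
      ((hslice x').intervalIntegrable _ _)]
    refine (intervalIntegral.norm_integral_le_of_norm_le_const (C := ε) fun y _ =>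
      hε _ _ _ _ hx (by simpa using hδ.le)).trans (le_of_eq ?_)
    rw [sub_zero, abs_of_pos Real.pi_pos, mul_comm]
  have houter := norm_riemannSum_sub_integral_le hGc hN hGε θ hθ
  have hinner : ∀ k ∈ Finset.range N,
      ‖((Real.pi / N : ℝ) : ℂ) * ∑ j ∈ Finset.range N, g (θ k, φ k j) - G (θ k)‖ ≤
        Real.pi * ε := fun k hk =>
    norm_riemannSum_sub_integral_le (hslice (θ k)) hN
      (fun y y' hy => hε _ _ _ _ (by simpa using hδ.le) hy) _ (hφ k (Finset.mem_range.1 hk))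
  have hsum := norm_sum_le_of_le _ hinner
  rw [Finset.sum_const, Finset.card_range, nsmul_eq_mul, Finset.sum_sub_distrib,
    ← Finset.mul_sum] at hsum
  have hsum' := mul_le_mul_of_nonneg_left hsum hδ.le
  rw [← Complex.norm_of_nonneg hδ.le, ← norm_mul, Complex.norm_of_nonneg hδ.le] at hsum'
  have hcancel : Real.pi / N * (N * (Real.pi * ε)) = Real.pi ^ 2 * ε := by field_simp
  rw [hcancel] at hsum'
  calc _ = ‖((Real.pi / N : ℝ) : ℂ) * (((Real.pi / N : ℝ) : ℂ) *
          ∑ k ∈ Finset.range N, ∑ j ∈ Finset.range N, g (θ k, φ k j) -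
            ∑ k ∈ Finset.range N, G (θ k)) +
        (((Real.pi / N : ℝ) : ℂ) * ∑ k ∈ Finset.range N, G (θ k) -
          ∫ x in (0)..Real.pi, G x)‖ := by congr 1; ring
    _ ≤ Real.pi ^ 2 * ε + Real.pi * (Real.pi * ε) := norm_add_le_of_le hsum' houter
    _ = _ := by ring

/-! ### Integrals over the cube -/

theorem integral_symm_eq_two_mul {g : ℝ → ℂ} (hg : Continuous g) (heven : ∀ x, g (-x) = g x) :
    ∫ x in (-Real.pi)..Real.pi, g x = 2 * ∫ x in (0)..Real.pi, g x := by
  rw [← intervalIntegral.integral_add_adjacent_intervals (b := 0)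
    (hg.intervalIntegrable _ _) (hg.intervalIntegrable _ _)]
  have h := intervalIntegral.integral_comp_neg (a := 0) (b := Real.pi) g
  simp only [heven, neg_zero] at h
  rw [← h, two_mul]

theorem setIntegral_Icc_pi {g : ℝ → ℂ} (hg : Continuous g) (heven : ∀ x, g (-x) = g x) :
    ∫ x in Set.Icc (-Real.pi) Real.pi, g x = 2 * ∫ x in (0)..Real.pi, g x := by
  rw [integral_Icc_eq_integral_Ioc, ← intervalIntegral.integral_of_le (by linarith [Real.pi_pos]),
    integral_symm_eq_two_mul hg heven]

/-- The eigenvalue angles fill only `[0, π]`; evenness of the symbol folds the cube onto it. -/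
theorem integral_angleCube_one {g : ℝ → ℂ} (hg : Continuous g) (heven : ∀ x, g (-x) = g x) :
    ∫ x in angleCube 1, g (x 0) = 2 * ∫ x in (0)..Real.pi, g x := by
  rw [← setIntegral_Icc_pi hg heven,
    ← (volume_preserving_funUnique (Fin 1) ℝ).setIntegral_preimage_emb
      (MeasurableEquiv.measurableEmbedding _)]
  congr 2
  ext x
  simp [angleCube, Set.mem_Icc, Pi.le_def]

theorem integral_angleCube_two {g : ℝ × ℝ → ℂ} (hg : Continuous g)
    (heven₁ : ∀ x y, g (-x, y) = g (x, y)) (heven₂ : ∀ x y, g (x, -y) = g (x, y)) :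
    ∫ x in angleCube 2, g (x 0, x 1) =
      4 * ∫ x in (0)..Real.pi, ∫ y in (0)..Real.pi, g (x, y) := by
  have hpre : angleCube 2 = (MeasurableEquiv.finTwoArrow (α := ℝ)) ⁻¹'
      (Set.Icc (-Real.pi) Real.pi ×ˢ Set.Icc (-Real.pi) Real.pi) := by
    ext x
    simp [angleCube, Set.mem_Icc, Pi.le_def, Fin.forall_fin_two]
  have hpres := (volume_preserving_finTwoArrow ℝ).setIntegral_preimage_emb
    (MeasurableEquiv.measurableEmbedding _) g
    (Set.Icc (-Real.pi) Real.pi ×ˢ Set.Icc (-Real.pi) Real.pi)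
  rw [hpre]
  refine hpres.trans ?_
  rw [Measure.volume_eq_prod, setIntegral_prod _
    (hg.continuousOn.integrableOn_compact (isCompact_Icc.prod isCompact_Icc))]
  have hin : ∀ x, ∫ y in Set.Icc (-Real.pi) Real.pi, g (x, y) =
      2 * ∫ y in (0)..Real.pi, g (x, y) := fun x =>
    setIntegral_Icc_pi (by fun_prop) (heven₂ x)
  simp only [hin]
  rw [setIntegral_Icc_pi (g := fun x => 2 * ∫ y in (0)..Real.pi, g (x, y))
    (continuous_const.mul (continuous_integral_right hg _ _))
    (by simp [heven₁]), intervalIntegral.integral_const_mul]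
  ring

theorem volume_angleCube (t : ℕ) : volume (angleCube t) = ENNReal.ofReal (2 * Real.pi) ^ t := by
  rw [angleCube, Real.volume_Icc_pi]
  simp [two_mul]

/-! ### Explicit eigenpairs -/

/-- Counterpart of `map_le_roots_charpoly` on the sampling side: the explicit eigenvalues, indexed
by inner cells, form a part of the full grid of samples. -/
theorem map_univ_le_map {κ σ τ : Type*} [Fintype κ] (e : κ ↪ σ) (T : Finset σ)
    (h : ∀ k, e k ∈ T) (l : σ → τ) :
    ((Finset.univ : Finset κ).val.map fun k => l (e k)) ≤ T.val.map l := by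
  have hle : (Finset.univ.map e).val ≤ T.val := Finset.val_le_iff.2 fun x hx => by
    obtain ⟨k, -, rfl⟩ := Finset.mem_map.1 hx
    exact h k
  have := Multiset.map_le_map (f := l) hle
  rwa [Finset.map_val, Multiset.map_map] at this

theorem cos_sub_injective {κ : Type*} (c : ℝ) (θ : κ → ℝ) (hθ : Function.Injective θ)
    (hmem : ∀ k, θ k ∈ Set.Icc 0 Real.pi) :
    Function.Injective fun k => ((c - 2 * Real.cos (θ k) : ℝ) : ℂ) := by
  intro k k' hk
  have : c - 2 * Real.cos (θ k) = c - 2 * Real.cos (θ k') := Complex.ofReal_injective hk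
  exact hθ (Real.injOn_cos (hmem k) (hmem k') (by linarith))

theorem mul_pi_div_mem_Icc {n m : ℕ} (hm : m ≤ n + 1) :
    (m : ℝ) * (Real.pi / (n + 1)) ∈ Set.Icc 0 Real.pi := by
  refine ⟨by positivity, ?_⟩
  have h : (m : ℝ) ≤ n + 1 := by exact_mod_cast hm
  calc (m : ℝ) * (Real.pi / (n + 1)) ≤ (n + 1) * (Real.pi / (n + 1)) := by gcongr
    _ = Real.pi := by field_simp

theorem exists_ghostTridiagonal_eigenvectors {n : ℕ} (hn : 1 ≤ n) (α γ : ℝ) {β : ℝ}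
    (hβ : 0 < β) :
    ∃ (φ : ℕ → ℝ) (u : Fin (n - 1) → Fin (n + 1) → ℂ),
      (∀ j, j * (Real.pi / (n + 1)) ≤ φ j ∧ φ j ≤ (j + 1) * (Real.pi / (n + 1))) ∧
      LinearIndependent ℂ u ∧
      ∀ j, (ghostTridiagonal n α β γ).mulVec (u j) =
        ((γ - 2 * Real.cos (φ (j.val + 1)) : ℝ) : ℂ) • u j := by
  choose φ h1 h2 h3 using exists_angle n (α - γ) hβ
  set u : Fin (n - 1) → Fin (n + 1) → ℂ := fun j i =>
    ((Real.sin ((n + 1 - i.val) * φ (j.val + 1)) : ℝ) : ℂ) with hu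
  have hδ : 0 < Real.pi / (n + 1) := by positivity
  have hin : ∀ j : Fin (n - 1), 1 ≤ j.val + 1 ∧ j.val + 1 < n := fun j => ⟨by omega, by omega⟩
  -- The roots lie in disjoint open cells, hence are distinct; as cosine is injective on `[0, π]`,
  -- so are the eigenvalues, which gives independence. The shift `j + 1` skips cell `0`.
  have hmono : StrictMono fun j : Fin (n - 1) => φ (j.val + 1) := by
    intro j j' hjj
    have hle : ((j.val + 1 : ℕ) : ℝ) + 1 ≤ ((j'.val + 1 : ℕ) : ℝ) := by
      exact_mod_cast Nat.succ_le_succ (show j.val + 1 ≤ j'.val from hjj)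
    calc φ (j.val + 1) < (((j.val + 1 : ℕ) : ℝ) + 1) * (Real.pi / (n + 1)) :=
          (h3 _ (hin j).1 (hin j).2).2.1
      _ ≤ ((j'.val + 1 : ℕ) : ℝ) * (Real.pi / (n + 1)) := by gcongr
      _ < φ (j'.val + 1) := (h3 _ (hin j').1 (hin j').2).1
  have hmem : ∀ j : Fin (n - 1), φ (j.val + 1) ∈ Set.Ioo 0 Real.pi := by
    intro j
    have hj := h3 _ (hin j).1 (hin j).2
    have hup := (mul_pi_div_mem_Icc (n := n) (m := j.val + 1 + 1) (by omega)).2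
    have hlow := (mul_pi_div_mem_Icc (n := n) (m := j.val + 1) (by omega)).1
    rw [Nat.cast_add (j.val + 1) 1, Nat.cast_one] at hup
    exact ⟨hlow.trans_lt hj.1, hj.2.1.trans_le hup⟩
  have heig : ∀ j, (ghostTridiagonal n α β γ).mulVec (u j) =
      ((γ - 2 * Real.cos (φ (j.val + 1)) : ℝ) : ℂ) • u j := fun j =>
    ghostTridiagonal_mulVec hn α β γ _ (h3 _ (hin j).1 (hin j).2).2.2
  refine ⟨φ, u, fun j => ⟨h1 j, h2 j⟩, ?_, heig⟩
  refine linearIndependent_of_eigenvectors (ghostTridiagonal n α β γ) u _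
    (cos_sub_injective γ (fun j : Fin (n - 1) => φ (j.val + 1)) hmono.injective
      fun j => Set.Ioo_subset_Icc_self (hmem j)) (fun j h0 => ?_) heig
  -- The last coordinate is `sin φ`, nonzero because `0 < φ < π`.
  have := congrFun h0 (Fin.last n)
  simp only [hu, Fin.val_last, add_sub_cancel_left, one_mul, Pi.zero_apply,
    Complex.ofReal_eq_zero] at this
  exact (Real.sin_pos_of_mem_Ioo (hmem j)).ne' this

/-- The `n × n` matrix `tridiag(-1, 4, -1)`. -/
def dirichletMatrix (n : ℕ) : Matrix (Fin n) (Fin n) ℂ :=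
  Matrix.of fun i j =>
    if i.val = j.val then 4 else if i.val = j.val + 1 ∨ j.val = i.val + 1 then -1 else 0

/-- The sine eigenvectors of `dirichletMatrix`. -/
noncomputable def sineVector (n : ℕ) (k : Fin n) : Fin n → ℂ := fun i =>
  ((Real.sin ((i.val + 1 : ℕ) * ((k.val + 1 : ℕ) * (Real.pi / (n + 1)))) : ℝ) : ℂ)

theorem dirichletMatrix_mulVec (n : ℕ) (k : Fin n) :
    (dirichletMatrix n).mulVec (sineVector n k) =
      ((4 - 2 * Real.cos ((k.val + 1 : ℕ) * (Real.pi / (n + 1))) : ℝ) : ℂ) • sineVector n k := by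
  funext i
  simp only [Matrix.mulVec, dotProduct, dirichletMatrix, sineVector, Matrix.of_apply,
    Pi.smul_apply, smul_eq_mul]
  set θ : ℝ := (k.val + 1 : ℕ) * (Real.pi / (n + 1)) with hθ
  have hend : ((n + 1 : ℕ) : ℝ) * θ = ((k.val + 1 : ℕ) : ℝ) * Real.pi := by
    rw [hθ]; push_cast; field_simp
  rw [sum_tridiagonal n 4 (-1) (fun m : ℕ => ((Real.sin ((m : ℝ) * θ) : ℝ) : ℂ)) i
    (fun _ => by simp) (by simp only [hend, Real.sin_nat_mul_pi, Complex.ofReal_zero])]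
  rw [show (i.val : ℝ) * θ = (i.val + 1 : ℕ) * θ - θ by push_cast; ring,
    show ((i.val + 2 : ℕ) : ℝ) * θ = (i.val + 1 : ℕ) * θ + θ by push_cast; ring,
    Real.sin_add, Real.sin_sub]
  push_cast
  ring

theorem linearIndependent_sineVector (n : ℕ) : LinearIndependent ℂ (sineVector n) := by
  have hmem : ∀ k : Fin n, ((k.val + 1 : ℕ) : ℝ) * (Real.pi / (n + 1)) ∈ Set.Ioo 0 Real.pi := by
    intro k
    have hup := (mul_pi_div_mem_Icc (n := n) (m := k.val + 1 + 1) (by omega)).2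
    have hδ : 0 < Real.pi / (n + 1) := by positivity
    rw [Nat.cast_add (k.val + 1) 1, Nat.cast_one] at hup
    exact ⟨by positivity, by linarith⟩
  refine linearIndependent_of_eigenvectors (dirichletMatrix n) _ _
    (cos_sub_injective 4 (fun k : Fin n => ((k.val + 1 : ℕ) : ℝ) * (Real.pi / (n + 1))) ?_
      fun k => Set.Ioo_subset_Icc_self (hmem k)) (fun k h0 => ?_) (dirichletMatrix_mulVec n)
  · intro k k' h
    have hδ : Real.pi / ((n : ℝ) + 1) ≠ 0 := by positivity
    have := mul_right_cancel₀ hδ h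
    ext
    exact Nat.succ_injective (by exact_mod_cast this)
  · have := congrFun h0 ⟨0, k.pos⟩
    simp only [sineVector, zero_add, Nat.cast_one, one_mul, Pi.zero_apply,
      Complex.ofReal_eq_zero] at this
    exact (Real.sin_pos_of_mem_Ioo (hmem k)).ne' this

/-! ### The spectra of the Coco--Russo matrices -/

/-- Scaling removes `h` from every row but the ghost row, where it enters only through `α` and `β`.
-/
theorem scaledMatrix1D_eq (b x₀ a : ℝ) (n : ℕ) (h : step1D b x₀ n ≠ 0) :
    scaledMatrix1D b x₀ a n = ghostTridiagonal n
      ((step1D b x₀ n ^ 2 * theta x₀ (step1D b x₀ n) a : ℝ) : ℂ)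
      ((step1D b x₀ n ^ 2 * (1 - theta x₀ (step1D b x₀ n) a) : ℝ) : ℂ) ((2 : ℝ) : ℂ) := by
  ext i j
  simp only [scaledMatrix1D, matrix1D, ghostTridiagonal, Matrix.map_apply, Matrix.smul_apply,
    Matrix.of_apply, smul_eq_mul]
  generalize step1D b x₀ n = h' at *
  have h2 : h' ^ 2 * (2 / h' ^ 2) = 2 := by field_simp
  have h1 : h' ^ 2 * -(1 / h' ^ 2) = -1 := by field_simp
  split_ifs <;> simp only [h1, h2, mul_zero] <;> push_cast <;> rfl

theorem scaledMatrix2D_apply (a : ℝ) (n : ℕ) (r s : Fin (n + 1)) (i k : Fin n) :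
    scaledMatrix2D a n (r, i) (s, k) =
      if r.val = 0 then
        (if s.val = 0 then ((step2D n ^ 2 * theta 0 (step2D n) a : ℝ) : ℂ)
          else if s.val = 1 then ((step2D n ^ 2 * (1 - theta 0 (step2D n) a) : ℝ) : ℂ) else 0) *
            (1 : Matrix (Fin n) (Fin n) ℂ) i k
      else if r.val = s.val then dirichletMatrix n i k
      else if r.val = s.val + 1 ∨ s.val = r.val + 1 then -(1 : Matrix (Fin n) (Fin n) ℂ) i k
      else 0 := by
  have hne : step2D n ≠ 0 := by unfold step2D; positivity
  simp only [scaledMatrix2D, matrix2D, Matrix.map_apply, Matrix.smul_apply, Matrix.of_apply,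
    smul_eq_mul, block2D]
  generalize step2D n = h at *
  have h4 : h ^ 2 * (4 / h ^ 2) = 4 := by field_simp
  have h1 : h ^ 2 * -(1 / h ^ 2) = -1 := by field_simp
  have hone : (((1 : Matrix (Fin n) (Fin n) ℝ) i k : ℝ) : ℂ) =
      (1 : Matrix (Fin n) (Fin n) ℂ) i k := by
    simp only [Matrix.one_apply]; split_ifs <;> simp
  by_cases hr : r.val = 0
  · simp only [hr, if_true]
    split_ifs <;>
      simp only [Matrix.smul_apply, smul_eq_mul, ← mul_assoc, Complex.ofReal_mul, hone,
        Matrix.zero_apply, mul_zero, zero_mul, Complex.ofReal_zero]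
  · simp only [hr, if_false]
    by_cases hrs : r.val = s.val
    · simp only [hrs, if_true, blockG, dirichletMatrix, Matrix.of_apply]
      split_ifs <;> simp only [h1, h4, mul_zero] <;> push_cast <;> rfl
    · simp only [hrs, if_false, blockB]
      split_ifs
      · rw [Matrix.smul_apply, smul_eq_mul, ← mul_assoc, h1, Complex.ofReal_mul, hone]
        push_cast
        ring
      · simp

/-- Every block is a multiple of the identity or equals `dirichletMatrix`, so `v` is an eigenvector
of all blocks at once and each block acts on it as a scalar. These scalars form `ghostTridiagonal`
with `γ` on the diagonal; the ghost row is the same for all `v`. -/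
theorem scaledMatrix2D_mulVec (a : ℝ) {n : ℕ} (u : Fin (n + 1) → ℂ) (v : Fin n → ℂ) (γ l : ℂ)
    (hv : (dirichletMatrix n).mulVec v = γ • v)
    (hu : (ghostTridiagonal n ((step2D n ^ 2 * theta 0 (step2D n) a : ℝ) : ℂ)
      ((step2D n ^ 2 * (1 - theta 0 (step2D n) a) : ℝ) : ℂ) γ).mulVec u = l • u) :
    (scaledMatrix2D a n).mulVec (fun q => u q.1 * v q.2) =
      l • fun q : Fin (n + 1) × Fin n => u q.1 * v q.2 := by
  funext ⟨r, i⟩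
  have hur := congrFun hu r
  have hvi := congrFun hv i
  have hone : ∑ k, (1 : Matrix (Fin n) (Fin n) ℂ) i k * v k = v i := by
    simp [Matrix.one_apply]
  simp only [Matrix.mulVec, dotProduct, Pi.smul_apply, smul_eq_mul] at hur hvi ⊢
  rw [Fintype.sum_prod_type, ← mul_assoc, ← hur, Finset.sum_mul]
  refine Finset.sum_congr rfl fun s _ => ?_
  have hinner : ∑ k, scaledMatrix2D a n (r, i) (s, k) * v k =
      ghostTridiagonal n ((step2D n ^ 2 * theta 0 (step2D n) a : ℝ) : ℂ)
        ((step2D n ^ 2 * (1 - theta 0 (step2D n) a) : ℝ) : ℂ) γ r s * v i := by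
    simp only [scaledMatrix2D_apply, ghostTridiagonal, Matrix.of_apply]
    split_ifs <;>
      simp only [mul_assoc, neg_mul, one_mul, zero_mul, Finset.sum_neg_distrib, ← Finset.mul_sum,
        hone, hvi, Finset.sum_const_zero]
  calc ∑ k, scaledMatrix2D a n (r, i) (s, k) * (u s * v k) =
      u s * ∑ k, scaledMatrix2D a n (r, i) (s, k) * v k := by
        rw [Finset.mul_sum]
        exact Finset.sum_congr rfl fun k _ => by ring
    _ = _ := by rw [hinner]; ring

theorem one_sub_theta_pos {x₀ h a : ℝ} (hh : 0 < h) (ha : x₀ < a) : 0 < 1 - theta x₀ h a := by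
  unfold theta
  rw [sub_pos, div_lt_one hh]
  linarith

/-- There are `n + 1` roots and `n + 1` samples with `n - 1` values in common, whence `2(n + 1) -
2(n - 1) = 4`. -/
theorem exists_angles_scaledMatrix1D {n : ℕ} (hn : 1 ≤ n) {b x₀ a : ℝ} (h1 : x₀ < a)
    (h2 : a < x₀ + step1D b x₀ n) :
    ∃ φ : ℕ → ℝ,
      (∀ j, j * (Real.pi / (n + 1)) ≤ φ j ∧ φ j ≤ (j + 1) * (Real.pi / (n + 1))) ∧
      ∀ (F : ℂ → ℂ) (M : ℝ), (∀ z, ‖F z‖ ≤ M) →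
        ‖((scaledMatrix1D b x₀ a n).charpoly.roots.map F).sum -
          ∑ j ∈ Finset.range (n + 1), F ((2 - 2 * Real.cos (φ j) : ℝ) : ℂ)‖ ≤ 4 * M := by
  have hh : 0 < step1D b x₀ n := by linarith
  obtain ⟨φ, u, hφ, hli, heig⟩ := exists_ghostTridiagonal_eigenvectors hn
    (step1D b x₀ n ^ 2 * theta x₀ (step1D b x₀ n) a) 2
    (mul_pos (pow_pos hh 2) (one_sub_theta_pos hh h1))
  refine ⟨φ, hφ, fun F M hM => ?_⟩
  rw [← scaledMatrix1D_eq b x₀ a n hh.ne'] at heig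
  have hroots := map_le_roots_charpoly _ u _ hli heig
  have hall := map_univ_le_map (κ := Fin (n - 1)) (σ := ℕ)
    ⟨fun j => j.val + 1, fun j j' h => Fin.ext (Nat.succ_injective h)⟩ (Finset.range (n + 1))
    (fun j => Finset.mem_range.2 (show j.val + 1 < n + 1 by omega)) (fun j => ((2 - 2 * Real.cos (φ j) : ℝ) : ℂ))
  have hcard : (scaledMatrix1D b x₀ a n).charpoly.roots.card = n + 1 := by
    rw [IsAlgClosed.card_roots_eq_natDegree, Matrix.charpoly_natDegree_eq_dim, Fintype.card_fin]
  have hmain := norm_sum_map_sub_le F M hM hroots hall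
  rw [hcard] at hmain
  simp only [Multiset.card_map, Finset.card_val, Finset.card_univ, Fintype.card_fin,
    Finset.card_range, Multiset.map_map] at hmain
  push_cast [Nat.cast_sub hn] at hmain
  refine le_trans (le_of_eq ?_) (hmain.trans (le_of_eq (by ring)))
  push_cast
  rfl

/-- Here `n(n + 1)` roots and `(n + 1)²` samples share `n(n - 1)` values, whence `n(n + 1) + (n +
1)² - 2n(n - 1) = 5n + 1`. -/
theorem exists_angles_scaledMatrix2D {n : ℕ} (hn : 1 ≤ n) {a : ℝ} (ha : 0 < a) :
    ∃ φ : ℕ → ℕ → ℝ,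
      (∀ k j, j * (Real.pi / (n + 1)) ≤ φ k j ∧ φ k j ≤ (j + 1) * (Real.pi / (n + 1))) ∧
      ∀ (F : ℂ → ℂ) (M : ℝ), (∀ z, ‖F z‖ ≤ M) →
        ‖((scaledMatrix2D a n).charpoly.roots.map F).sum -
          ∑ k ∈ Finset.range (n + 1), ∑ j ∈ Finset.range (n + 1),
            F ((4 - 2 * Real.cos (k * (Real.pi / (n + 1))) - 2 * Real.cos (φ k j) : ℝ) : ℂ)‖ ≤
          (5 * n + 1) * M := by
  have hh : 0 < step2D n := by unfold step2D; positivity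
  have hβ := mul_pos (pow_pos hh 2) (one_sub_theta_pos hh ha)
  -- Angles are chosen for every `k`, including `k = 0`, which carries no sine eigenvector but
  -- completes the grid of samples.
  choose φ u hφ hli heig using fun k : ℕ => exists_ghostTridiagonal_eigenvectors hn
    (step2D n ^ 2 * theta 0 (step2D n) a) (4 - 2 * Real.cos (k * (Real.pi / (n + 1)))) hβ
  refine ⟨φ, hφ, fun F M hM => ?_⟩
  have hroots := map_le_roots_charpoly (scaledMatrix2D a n)
    (fun (p : Fin n × Fin (n - 1)) q => u (p.1.val + 1) p.2 q.1 * sineVector n p.1 q.2) _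
    (linearIndependent_mul (sineVector n) (fun k => u (k.val + 1))
      (linearIndependent_sineVector n) fun k => hli _)
    fun p => scaledMatrix2D_mulVec a _ _ _ _ (dirichletMatrix_mulVec n p.1)
      (heig (p.1.val + 1) p.2)
  have hall := map_univ_le_map (κ := Fin n × Fin (n - 1)) (σ := ℕ × ℕ)
    ⟨fun p => (p.1.val + 1, p.2.val + 1), fun p p' h => by
      simp only [Prod.mk.injEq, Nat.add_right_cancel_iff] at h
      exact Prod.ext (Fin.ext h.1) (Fin.ext h.2)⟩
    (Finset.range (n + 1) ×ˢ Finset.range (n + 1)) (fun p => Finset.mem_product.2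
      ⟨Finset.mem_range.2 (show p.1.val + 1 < n + 1 by omega),
        Finset.mem_range.2 (show p.2.val + 1 < n + 1 by omega)⟩)
    (fun p => ((4 - 2 * Real.cos (p.1 * (Real.pi / (n + 1))) - 2 * Real.cos (φ p.1 p.2) : ℝ) : ℂ))
  have hcard : (scaledMatrix2D a n).charpoly.roots.card = (n + 1) * n := by
    rw [IsAlgClosed.card_roots_eq_natDegree, Matrix.charpoly_natDegree_eq_dim, Fintype.card_prod,
      Fintype.card_fin, Fintype.card_fin]
  have hmain := norm_sum_map_sub_le F M hM hroots hall
  rw [hcard] at hmain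
  simp only [Multiset.card_map, Finset.card_val, Finset.card_univ, Fintype.card_prod,
    Fintype.card_fin, Finset.card_product, Finset.card_range, Multiset.map_map] at hmain
  push_cast [Nat.cast_sub hn] at hmain
  refine le_trans (le_of_eq ?_) (hmain.trans (le_of_eq (by ring)))
  rw [← Finset.sum_product']
  push_cast
  rfl

/-! ### The limits -/

/-- A uniform modulus of continuity at the mesh size `π / (n + 1)`. -/
theorem eventually_norm_sub_le {E : Type*} [PseudoMetricSpace E] {g : E → ℂ}
    (hg : UniformContinuous g) {ε : ℝ} (hε : 0 < ε) :
    ∀ᶠ n : ℕ in atTop, ∀ x y, dist x y ≤ Real.pi / ((n + 1 : ℕ) : ℝ) → ‖g x - g y‖ ≤ ε := by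
  obtain ⟨δ, hδ, h⟩ := Metric.uniformContinuous_iff.1 hg ε hε
  have hlim : Tendsto (fun n : ℕ => Real.pi / ((n + 1 : ℕ) : ℝ)) atTop (𝓝 0) :=
    (tendsto_const_div_atTop_nhds_zero_nat Real.pi).comp (tendsto_add_atTop_nat 1)
  filter_upwards [hlim.eventually_lt_const hδ] with n hn x y hxy
  rw [← dist_eq_norm]
  exact (h (hxy.trans_lt hn)).le

theorem tendsto_eigenvalueMean_scaledMatrix1D (b : ℝ) (x₀ a : ℕ → ℝ)
    (h : ∀ n : ℕ, 1 ≤ n → x₀ n < a n ∧ a n < x₀ n + step1D b (x₀ n) n)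
    {F : ℂ → ℂ} (hF : Continuous F) (hFc : HasCompactSupport F) :
    Tendsto (fun n => eigenvalueMean (scaledMatrix1D b (x₀ n) (a n) n) F) atTop
      (𝓝 ((Real.pi : ℂ)⁻¹ *
        ∫ x in (0)..Real.pi, F ((2 - 2 * Real.cos x : ℝ) : ℂ))) := by
  obtain ⟨M, hM⟩ := hFc.exists_bound_of_continuous hF
  set g : ℝ → ℂ := fun x => F ((2 - 2 * Real.cos x : ℝ) : ℂ) with hg
  have hgc : Continuous g := by fun_prop
  -- `F` is uniformly continuous by compact support and the symbol is Lipschitz, so one modulus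
  -- works on the whole line.
  have hgu : UniformContinuous g := by
    refine (hFc.uniformContinuous_of_continuous hF).comp ?_
    refine Complex.isometry_ofReal.uniformContinuous.comp ?_
    have := (LipschitzWith.uniformContinuous (lipschitzWith_smul (2 : ℝ) (β := ℝ))).comp
      Real.lipschitzWith_cos.uniformContinuous
    exact uniformContinuous_const.sub this
  choose! φ hφ hR using fun n hn => exists_angles_scaledMatrix1D hn (h n hn).1 (h n hn).2
  set R : ℕ → ℂ := fun n => ((scaledMatrix1D b (x₀ n) (a n) n).charpoly.roots.map F).sum
    with hRdef
  set S : ℕ → ℂ := fun n => ∑ j ∈ Finset.range (n + 1), g (φ n j) with hS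
  have hlim : Tendsto (fun n : ℕ => Real.pi / ((n + 1 : ℕ) : ℝ)) atTop (𝓝 0) :=
    (tendsto_const_div_atTop_nhds_zero_nat Real.pi).comp (tendsto_add_atTop_nat 1)
  have hdiff : Tendsto (fun n : ℕ => ((Real.pi / ((n + 1 : ℕ) : ℝ) : ℝ) : ℂ) * (R n - S n))
      atTop (𝓝 0) := by
    have hbound := hlim.mul_const (4 * M)
    rw [zero_mul] at hbound
    refine squeeze_zero_norm' ?_ hbound
    filter_upwards [eventually_ge_atTop 1] with n hn
    have hδ : 0 ≤ Real.pi / ((n + 1 : ℕ) : ℝ) := by positivity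
    rw [norm_mul, Complex.norm_of_nonneg hδ]
    exact mul_le_mul_of_nonneg_left (hR n hn F M hM) hδ
  have hriem : Tendsto (fun n : ℕ => ((Real.pi / ((n + 1 : ℕ) : ℝ) : ℝ) : ℂ) * S n)
      atTop (𝓝 (∫ x in (0)..Real.pi, g x)) := by
    rw [Metric.tendsto_nhds]
    intro ε hε
    filter_upwards [eventually_ge_atTop 1,
      eventually_norm_sub_le hgu (show 0 < ε / (2 * Real.pi) by positivity)] with n hn hmod
    rw [dist_eq_norm]
    refine (norm_riemannSum_sub_integral_le hgc n.succ_pos (ε := ε / (2 * Real.pi))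
      (fun x y hxy => hmod x y hxy) (φ n) fun j _ => ?_).trans_lt ?_
    · push_cast
      exact hφ n hn j
    · calc Real.pi * (ε / (2 * Real.pi)) = ε / 2 := by field_simp
        _ < ε := by linarith
  have hsum := (hdiff.add hriem).const_mul (Real.pi : ℂ)⁻¹
  rw [zero_add] at hsum
  refine hsum.congr fun n => ?_
  have hpi : (Real.pi : ℂ) ≠ 0 := Complex.ofReal_ne_zero.2 Real.pi_ne_zero
  have hn : (n : ℂ) + 1 ≠ 0 := by exact_mod_cast n.succ_ne_zero
  simp only [eigenvalueMean, Fintype.card_fin]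
  rw [← mul_add, sub_add_cancel]
  push_cast
  field_simp
  rfl

theorem tendsto_eigenvalueMean_scaledMatrix2D (a : ℕ → ℝ)
    (h : ∀ n : ℕ, 1 ≤ n → 0 < a n ∧ a n < step2D n)
    {F : ℂ → ℂ} (hF : Continuous F) (hFc : HasCompactSupport F) :
    Tendsto (fun n => eigenvalueMean (scaledMatrix2D (a n) n) F) atTop
      (𝓝 (((Real.pi : ℂ) ^ 2)⁻¹ * ∫ x in (0)..Real.pi, ∫ y in (0)..Real.pi,
        F ((4 - 2 * Real.cos x - 2 * Real.cos y : ℝ) : ℂ))) := by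
  obtain ⟨M, hM⟩ := hFc.exists_bound_of_continuous hF
  set g : ℝ × ℝ → ℂ := fun p => F ((4 - 2 * Real.cos p.1 - 2 * Real.cos p.2 : ℝ) : ℂ) with hg
  have hgc : Continuous g := by fun_prop
  have hgu : UniformContinuous g := by
    refine (hFc.uniformContinuous_of_continuous hF).comp ?_
    refine Complex.isometry_ofReal.uniformContinuous.comp ?_
    have := (LipschitzWith.uniformContinuous (lipschitzWith_smul (2 : ℝ) (β := ℝ))).comp
      Real.lipschitzWith_cos.uniformContinuous
    exact (uniformContinuous_const.sub (this.comp uniformContinuous_fst)).sub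
      (this.comp uniformContinuous_snd)
  choose! φ hφ hR using fun n hn => exists_angles_scaledMatrix2D hn (h n hn).1
  set R : ℕ → ℂ := fun n => ((scaledMatrix2D (a n) n).charpoly.roots.map F).sum with hRdef
  set S : ℕ → ℂ := fun n => ∑ k ∈ Finset.range (n + 1), ∑ j ∈ Finset.range (n + 1),
    g (k * (Real.pi / (n + 1)), φ n k j) with hS
  have hM0 : 0 ≤ M := (norm_nonneg _).trans (hM 0)
  have hlim : Tendsto (fun n : ℕ => Real.pi / ((n + 1 : ℕ) : ℝ)) atTop (𝓝 0) :=
    (tendsto_const_div_atTop_nhds_zero_nat Real.pi).comp (tendsto_add_atTop_nat 1)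
  have hdiff : Tendsto (fun n : ℕ => ((Real.pi / ((n + 1 : ℕ) : ℝ) : ℝ) : ℂ) ^ 2 *
      (R n - S n)) atTop (𝓝 0) := by
    have hbound := hlim.mul_const (5 * Real.pi * M)
    rw [zero_mul] at hbound
    refine squeeze_zero_norm' ?_ hbound
    filter_upwards [eventually_ge_atTop 1] with n hn
    rw [norm_mul, norm_pow, Complex.norm_of_nonneg (by positivity)]
    calc (Real.pi / ((n + 1 : ℕ) : ℝ)) ^ 2 * ‖R n - S n‖
        ≤ (Real.pi / ((n + 1 : ℕ) : ℝ)) ^ 2 * (5 * ((n + 1 : ℕ) : ℝ) * M) := by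
          refine mul_le_mul_of_nonneg_left ((hR n hn F M hM).trans ?_) (by positivity)
          refine mul_le_mul_of_nonneg_right ?_ hM0
          push_cast
          linarith
      _ = Real.pi / ((n + 1 : ℕ) : ℝ) * (5 * Real.pi * M) := by field_simp
  have hriem : Tendsto (fun n : ℕ => ((Real.pi / ((n + 1 : ℕ) : ℝ) : ℝ) : ℂ) ^ 2 * S n)
      atTop (𝓝 (∫ x in (0)..Real.pi, ∫ y in (0)..Real.pi, g (x, y))) := by
    rw [Metric.tendsto_nhds]
    intro ε hε
    filter_upwards [eventually_ge_atTop 1,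
      eventually_norm_sub_le hgu (show 0 < ε / (4 * Real.pi ^ 2) by positivity)] with n hn hmod
    rw [dist_eq_norm]
    refine (norm_riemannSum_sub_integral_le₂ hgc n.succ_pos (ε := ε / (4 * Real.pi ^ 2))
      (fun x y x' y' hx hy => hmod (x, y) (x', y') (max_le hx hy))
      (fun k => k * (Real.pi / (n + 1))) (φ n) (fun j _ => ?_) fun k _ j _ => ?_).trans_lt ?_
    · push_cast
      exact ⟨le_rfl, mul_le_mul_of_nonneg_right (by linarith) (by positivity)⟩
    · push_cast
      exact hφ n hn k j
    · calc 2 * Real.pi ^ 2 * (ε / (4 * Real.pi ^ 2)) = ε / 2 := by field_simp; norm_num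
        _ < ε := by linarith
  -- The mean divides by `n(n + 1)`, the Riemann sum by `(n + 1)²`; this ratio corrects for it.
  have hratio : Tendsto (fun n : ℕ => ((n : ℂ) + 1) / n) atTop (𝓝 1) := by
    have h1 : Tendsto (fun n : ℕ => 1 + (n : ℂ)⁻¹) atTop (𝓝 (1 + 0)) :=
      tendsto_const_nhds.add (tendsto_inv_atTop_nhds_zero_nat (𝕜 := ℂ))
    rw [add_zero] at h1
    refine h1.congr' ?_
    filter_upwards [eventually_ge_atTop 1] with n hn
    have hn' : (n : ℂ) ≠ 0 := by exact_mod_cast (by omega : n ≠ 0)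
    field_simp
  have hsum := ((hdiff.add hriem).const_mul ((Real.pi : ℂ) ^ 2)⁻¹).mul hratio
  rw [zero_add, mul_one] at hsum
  refine hsum.congr' ?_
  filter_upwards [eventually_ge_atTop 1] with n hn
  have hpi : (Real.pi : ℂ) ≠ 0 := Complex.ofReal_ne_zero.2 Real.pi_ne_zero
  have hn0 : (n : ℂ) ≠ 0 := by exact_mod_cast (by omega : n ≠ 0)
  have hn1 : (n : ℂ) + 1 ≠ 0 := by exact_mod_cast n.succ_ne_zero
  simp only [eigenvalueMean, Fintype.card_prod, Fintype.card_fin]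
  rw [← mul_add, sub_add_cancel]
  push_cast
  field_simp
  rfl

theorem volume_angleCube_toReal (t : ℕ) :
    ((volume (angleCube t)).toReal : ℂ) = (2 * Real.pi) ^ t := by
  rw [volume_angleCube, ENNReal.toReal_pow, ENNReal.toReal_ofReal (by positivity)]
  push_cast
  rfl

theorem hasSpectralDistribution_angleCube {ι : ℕ → Type} [∀ n, Fintype (ι n)]
    [∀ n, DecidableEq (ι n)] (A : (n : ℕ) → Matrix (ι n) (ι n) ℂ) {t : ℕ}
    {f : (Fin t → ℝ) → ℂ} (hf : Continuous f)
    (h : ∀ F : ℂ → ℂ, Continuous F → HasCompactSupport F →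
      Tendsto (fun n => eigenvalueMean (A n) F) atTop
        (𝓝 (((2 * Real.pi : ℂ) ^ t)⁻¹ * ∫ x in angleCube t, F (f x)))) :
    HasSpectralDistribution A (angleCube t) f where
  measurableSet_domain := measurableSet_Icc
  volume_domain_pos := by
    rw [volume_angleCube]
    exact ENNReal.pow_pos (ENNReal.ofReal_pos.2 (by positivity)) t
  volume_domain_lt_top := by
    rw [volume_angleCube]
    exact ENNReal.pow_lt_top ENNReal.ofReal_lt_top
  measurable_symbol := hf.measurable.comp measurable_subtype_coe
  tendsto_eigenvalueMean F hF hFc := by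
    rw [volume_angleCube_toReal]
    exact h F hF hFc

end CocoRusso

theorem mainTheorem1 :
    (∀ (b : ℝ) (x₀ a : ℕ → ℝ),
      (∀ n : ℕ, 1 ≤ n → x₀ n < a n ∧ a n < x₀ n + CocoRusso.step1D b (x₀ n) n) →
      CocoRusso.HasSpectralDistribution
        (fun n => CocoRusso.scaledMatrix1D b (x₀ n) (a n) n)
        (CocoRusso.angleCube 1)
        (fun θ => ((2 - 2 * Real.cos (θ 0) : ℝ) : ℂ))) ∧
    (∀ a : ℕ → ℝ,
      (∀ n : ℕ, 1 ≤ n → 0 < a n ∧ a n < CocoRusso.step2D n) →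
      CocoRusso.HasSpectralDistribution
        (fun n => CocoRusso.scaledMatrix2D (a n) n)
        (CocoRusso.angleCube 2)
        (fun θ => ((4 - 2 * Real.cos (θ 0) - 2 * Real.cos (θ 1) : ℝ) : ℂ))) := by
  refine ⟨fun b x₀ a h => ?_, fun a h => ?_⟩
  · refine CocoRusso.hasSpectralDistribution_angleCube _ (by fun_prop) fun F hF hFc => ?_
    rw [CocoRusso.integral_angleCube_one
      (g := fun x => F ((2 - 2 * Real.cos x : ℝ) : ℂ)) (by fun_prop) (by simp),
      show ∀ z : ℂ, ((2 * Real.pi : ℂ) ^ 1)⁻¹ * (2 * z) = (Real.pi : ℂ)⁻¹ * z from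
        fun z => by rw [pow_one, mul_inv]; ring]
    exact CocoRusso.tendsto_eigenvalueMean_scaledMatrix1D b x₀ a h hF hFc
  · refine CocoRusso.hasSpectralDistribution_angleCube _ (by fun_prop) fun F hF hFc => ?_
    rw [CocoRusso.integral_angleCube_two
      (g := fun p => F ((4 - 2 * Real.cos p.1 - 2 * Real.cos p.2 : ℝ) : ℂ)) (by fun_prop)
      (by simp) (by simp),
      show ∀ z : ℂ, ((2 * Real.pi : ℂ) ^ 2)⁻¹ * (4 * z) = ((Real.pi : ℂ) ^ 2)⁻¹ * z from
        fun z => by rw [mul_pow, mul_inv]; ring]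
    exact CocoRusso.tendsto_eigenvalueMean_scaledMatrix2D a h hF hFc
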